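/- Let $X$ be a (real or complex) Banach space and let $(C(t))_{t\in\mathbb R}$ be a strongly continuous cosine family of bounded linear operators on $X$, that is, $C(0)=I$, $C(t+s)+C(t-s)=2C(t)C(s)$ for all $s,t\in\mathbb R$, and $t\mapsto C(t)x$ is continuous for every $x\in X$. Suppose that $\|C(t)\|\le\mathcal K$ for all $t\in\mathbb R$, for some constant $\mathcal K\ge 1$, and let $S(t)x=\int_0^t C(r)x\,dr$ be the associated sine family. Let $T>0$, let $\psi\in C^1([0,T];\mathbb R)$ be strictly increasing, let $1<\alpha\le 2$ and $q=\alpha/2$. For $\tfrac12<q<1$ let $$M_q(\theta)=\sum_{n=0}^{\infty}\frac{(-\theta)^n}{n!\,\Gamma(1-q(n+1))},\qquad \theta\ge 0,$$ (with $1/\Gamma=0$ at the poles of $\Gamma$) be Mainardi's Wright-type function, and for $0\le s\le t\le T$, $x\in X$ put $$P_q^\psi(t,s)x=\int_0^{\infty}q\,\theta\,M_q(\theta)\,S\big((\psi(t)-\psi(s))^q\theta\big)x\,d\theta .$$ For $q=1$, where $M_q$ degenerates to the unit point mass at $\theta=1$, put $P_1^\psi(t,s)x=S(\psi(t)-\psi(s))x$.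 Let $u\in X$. For $q<1$ the series defining $M_q(\theta)$ converges absolutely for every $\theta\ge0$, and the integral defining $P_q^\psi(t,s)u$ converges absolutely for all $0\le s\le t\le T$. Moreover: 1. For every $s\in[0,T]$, $\displaystyle\lim_{t_1\to s,\ s<t_1\le T}(\psi(t_1)-\psi(s))^{q-1}P_q^\psi(t_1,s)u=0$ (no claim is made by this item for $s=T$). 2. For $0\le s\le t_1\le t_2\le T$, $$\big\|(\psi(t_2)-\psi(s))^{q-1}P_q^\psi(t_2,s)u-(\psi(t_1)-\psi(s))^{q-1}P_q^\psi(t_1,s)u\big\|_X\longrightarrow 0\quad\text{as } t_2-t_1\to0,$$ that is, for every $\varepsilon>0$ there is $\delta>0$ such that this norm is less than $\varepsilon$ for all $0\le s\le t_1\le t_2\le T$ with $t_2-t_1<\delta$. Here $(\psi(t)-\psi(s))^{q-1}P_q^\psi(t,s)u$ is understood to be $0$ for $t=s$. In particular it is continuous in $t\in[s,T]$. -/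

import Mathlib

open Set Filter Topology MeasureTheory

noncomputable section

/-- A strongly continuous cosine family of bounded linear operators on `X`. -/
structure IsCosineFamily {𝕜 X : Type*} [RCLike 𝕜] [NormedAddCommGroup X] [NormedSpace 𝕜 X]
    (C : ℝ → X →L[𝕜] X) : Prop where
  map_zero : C 0 = ContinuousLinearMap.id 𝕜 X
  add_add_sub : ∀ s t : ℝ, C (t + s) + C (t - s) = (2 : 𝕜) • (C t).comp (C s)
  continuous_apply : ∀ x : X, Continuous fun t : ℝ => C t x

/-- The sine family `S(t)x = ∫₀ᵗ C(r)x dr` associated with `C`. -/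
def sineFamily {𝕜 X : Type*} [RCLike 𝕜] [NormedAddCommGroup X] [NormedSpace ℝ X]
    [NormedSpace 𝕜 X] (C : ℝ → X →L[𝕜] X) (t : ℝ) (x : X) : X :=
  ∫ r in (0 : ℝ)..t, C r x

/-- The `n`-th term `(-z)ⁿ / (n! Γ(1 - q(n+1)))` of Mainardi's Wright-type series. As usual `1/Γ`
is `0` at the poles of `Γ`; this is what Mathlib's conventions `Γ(-k) = 0` and `1/0 = 0` give. -/
def mainardiWrightTerm (q z : ℝ) (n : ℕ) : ℝ :=
  (-z) ^ n / ((n.factorial : ℝ) * Real.Gamma (1 - q * ((n : ℝ) + 1)))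

/-- Mainardi's Wright-type function `M_q`, for `0 < q < 1`. -/
def mainardiWright (q z : ℝ) : ℝ :=
  ∑' n : ℕ, mainardiWrightTerm q z n

/-- The integrand `θ ↦ q θ M_q(θ) S((ψ(t) - ψ(s))^q θ) x` in the definition of `P_q^ψ(t,s)x`. -/
def psiSineIntegrand {𝕜 X : Type*} [RCLike 𝕜] [NormedAddCommGroup X] [NormedSpace ℝ X]
    [NormedSpace 𝕜 X] (C : ℝ → X →L[𝕜] X) (ψ : ℝ → ℝ) (q t s : ℝ) (x : X) (θ : ℝ) : X :=
  (q * θ * mainardiWright q θ) • sineFamily C ((ψ t - ψ s) ^ q * θ) x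

open Classical in
/-- The operator `P_q^ψ(t,s)x = ∫₀^∞ q θ M_q(θ) S((ψ(t) - ψ(s))^q θ) x dθ`.
For `q = 1` the function `M_q` degenerates to the unit point mass at `θ = 1` (the measure whose
`n`-th moment is `Γ(1+n)/Γ(1+nq) = 1` for all `n`), so that the integral is `S(ψ(t) - ψ(s))x`. -/
def psiSineOperator {𝕜 X : Type*} [RCLike 𝕜] [NormedAddCommGroup X] [NormedSpace ℝ X]
    [NormedSpace 𝕜 X] (C : ℝ → X →L[𝕜] X) (ψ : ℝ → ℝ) (q t s : ℝ) (x : X) : X :=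
  if q = 1 then sineFamily C (ψ t - ψ s) x
  else ∫ θ in Ioi (0 : ℝ), psiSineIntegrand C ψ q t s x θ

end

/-! The norm bound on $C$ makes $S(\cdot)x$ Lipschitz with constant $\mathcal K\|x\|$, so
$P_q^\psi(t,s)x$ is Lipschitz in $(\psi(t)-\psi(s))^q$ once
$\int_0^\infty\theta^2|M_q(\theta)|\,d\theta<\infty$ (for $q=1$ directly). It depends only on
$z=\psi(t)-\psi(s)$ and vanishes at $z=0$, hence $\|z^{q-1}P\|\le Lz^{2q-1}$, which tends to $0$
because $q>1/2$. So $z^{q-1}P$ is continuous on $[0,\infty)$ and uniformly continuous on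
$[0,\psi(T)-\psi(0)]$; composing with the uniformly continuous $\psi$ gives both claims.

The work is the second moment, obtained from decay of $M_q$ without using its sign. The reflection
formula and Euler's integral on a rotated ray give $\pi M_q(\theta)=\operatorname{Im}\int
w^{q-1}e^{w-\theta w^q}\,dw$ along $\arg w=\beta$. Choosing $\beta>\pi/2$ with $q\beta<\pi/2$ makes
both $e^w$ and $e^{-\theta w^q}$ bounded. Replacing $e^w$ by $1$ or $w$ gives real integrals, so
only $e^w-1-w=O(|w|^2)$ contributes, and $M_q(\theta)=O(\theta^{-(q+2)/q})$
(`exists_abs_mainardiWright_le`). -/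

/-! ### Euler's Gamma integral with complex rate -/

theorem norm_rpow_mul_cexp {t : ℝ} (ht : 0 < t) (s : ℝ) (r : ℂ) :
    ‖((t ^ s : ℝ) : ℂ) * Complex.exp (-(r * t))‖ = t ^ s * Real.exp (-(r.re * t)) := by
  rw [norm_mul, Complex.norm_real, Real.norm_of_nonneg (by positivity), Complex.norm_exp]
  simp

theorem integrableOn_rpow_mul_exp_neg_mul {s c : ℝ} (hs : -1 < s) (hc : 0 < c) :
    IntegrableOn (fun t : ℝ => t ^ s * Real.exp (-(c * t))) (Ioi 0) := by
  simpa using integrableOn_rpow_mul_exp_neg_mul_rpow hs one_pos hc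

theorem continuousOn_rpow_mul_cexp (s : ℝ) (r : ℂ) :
    ContinuousOn (fun t : ℝ => ((t ^ s : ℝ) : ℂ) * Complex.exp (-(r * t))) (Ioi 0) := by
  refine ContinuousOn.mul ?_ (by fun_prop)
  refine Complex.continuous_ofReal.comp_continuousOn ?_
  exact continuousOn_id.rpow_const fun t ht => Or.inl (ne_of_gt ht)

theorem integrableOn_rpow_mul_cexp {s : ℝ} {r : ℂ} (hs : -1 < s) (hr : 0 < r.re) :
    IntegrableOn (fun t : ℝ => ((t ^ s : ℝ) : ℂ) * Complex.exp (-(r * t))) (Ioi 0) := by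
  refine Integrable.mono' (integrableOn_rpow_mul_exp_neg_mul hs hr)
    ((continuousOn_rpow_mul_cexp s r).aestronglyMeasurable measurableSet_Ioi) ?_
  filter_upwards [ae_restrict_mem measurableSet_Ioi] with t ht
  exact (norm_rpow_mul_cexp ht s r).le

/-- Differentiation under the integral sign: near $r$ the real part stays above $\operatorname{Re}
r/2$, which gives an integrable majorant. Holomorphy is what lets the identity theorem extend
Euler's formula from the positive axis. -/
theorem differentiableAt_integral_rpow_mul_cexp {s : ℝ} {r : ℂ} (hs : 0 < s) (hr : 0 < r.re) :
    DifferentiableAt ℂ (fun z : ℂ => ∫ t in Ioi (0 : ℝ),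
      ((t ^ (s - 1) : ℝ) : ℂ) * Complex.exp (-(z * t))) r := by
  have hball : ∀ z ∈ Metric.ball r (r.re / 2), r.re / 2 < z.re := by
    intro z hz
    have h1 := (Complex.abs_re_le_norm (z - r)).trans_lt (mem_ball_iff_norm.1 hz)
    rw [Complex.sub_re] at h1
    linarith [(abs_lt.1 h1).1]
  have hd := hasDerivAt_integral_of_dominated_loc_of_deriv_le (𝕜 := ℂ)
    (μ := volume.restrict (Ioi (0 : ℝ))) (s := Metric.ball r (r.re / 2)) (x₀ := r)
    (F := fun z t => ((t ^ (s - 1) : ℝ) : ℂ) * Complex.exp (-(z * t)))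
    (F' := fun z t => ((t ^ (s - 1) : ℝ) : ℂ) * (Complex.exp (-(z * t)) * (-t)))
    (bound := fun t => t ^ s * Real.exp (-(r.re / 2 * t)))
    (Metric.ball_mem_nhds _ (by linarith)) ?_
    (integrableOn_rpow_mul_cexp (by linarith) hr) ?_ ?_
    (integrableOn_rpow_mul_exp_neg_mul (by linarith) (by linarith)) ?_
  · exact hd.2.differentiableAt
  · exact Eventually.of_forall fun z =>
      (continuousOn_rpow_mul_cexp _ z).aestronglyMeasurable measurableSet_Ioi
  · have := (((continuousOn_rpow_mul_cexp (s - 1) r).mul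
      (g := fun t : ℝ => (-t : ℂ)) (by fun_prop))).aestronglyMeasurable (μ := volume)
      measurableSet_Ioi
    exact this.congr (Eventually.of_forall fun t => mul_assoc _ _ _)
  · filter_upwards [ae_restrict_mem measurableSet_Ioi] with t ht z hz
    have ht : 0 < t := ht
    rw [← mul_assoc, norm_mul, norm_rpow_mul_cexp ht, norm_neg, Complex.norm_real,
      Real.norm_of_nonneg ht.le, mul_right_comm, ← Real.rpow_add_one ht.ne', sub_add_cancel]
    have := hball z hz
    gcongr
  · refine Eventually.of_forall fun t z _ => ?_
    have h1 : HasDerivAt (fun z : ℂ => -(z * t)) (-(t : ℂ)) z := by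
      simpa using! ((hasDerivAt_id z).mul_const (t : ℂ)).neg
    exact h1.cexp.const_mul _

/-- Euler's integral along a ray in the right half plane. -/
theorem integral_rpow_mul_cexp {s : ℝ} {r : ℂ} (hs : 0 < s) (hr : 0 < r.re) :
    ∫ t in Ioi (0 : ℝ), ((t ^ (s - 1) : ℝ) : ℂ) * Complex.exp (-(r * t)) =
      r ^ (-s : ℂ) * (Real.Gamma s : ℂ) := by
  set U : Set ℂ := {z | 0 < z.re} with hU
  have hUo : IsOpen U := isOpen_lt continuous_const Complex.continuous_re
  have hUc : IsPreconnected U := (convex_halfSpace_re_gt 0).isPreconnected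
  have hf : AnalyticOnNhd ℂ (fun z : ℂ => ∫ t in Ioi (0 : ℝ),
      ((t ^ (s - 1) : ℝ) : ℂ) * Complex.exp (-(z * t))) U :=
    DifferentiableOn.analyticOnNhd (fun z hz =>
      (differentiableAt_integral_rpow_mul_cexp hs hz).differentiableWithinAt) hUo
  have hg : AnalyticOnNhd ℂ (fun z : ℂ => z ^ (-s : ℂ) * (Real.Gamma s : ℂ)) U := by
    refine DifferentiableOn.analyticOnNhd (fun z hz => ?_) hUo
    refine DifferentiableAt.differentiableWithinAt ?_
    exact (differentiableAt_id.cpow_const (Or.inl hz)).mul_const _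
  have hreal : ∀ x : ℝ, 0 < x →
      ∫ t in Ioi (0 : ℝ), ((t ^ (s - 1) : ℝ) : ℂ) * Complex.exp (-((x : ℂ) * t)) =
        (x : ℂ) ^ (-s : ℂ) * (Real.Gamma s : ℂ) := by
    intro x hx
    have h1 := Real.integral_rpow_mul_exp_neg_mul_Ioi hs hx
    rw [one_div, Real.inv_rpow hx.le, ← Real.rpow_neg hx.le] at h1
    rw [← Complex.ofReal_neg, ← Complex.ofReal_cpow hx.le, ← Complex.ofReal_mul, ← h1,
      ← integral_complex_ofReal]
    simp
  have hfreq : ∃ᶠ z in 𝓝[≠] (1 : ℂ), (∫ t in Ioi (0 : ℝ),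
      ((t ^ (s - 1) : ℝ) : ℂ) * Complex.exp (-(z * t))) = z ^ (-s : ℂ) * (Real.Gamma s : ℂ) := by
    have ht : Tendsto (fun x : ℝ => (x : ℂ)) (𝓝[>] 1) (𝓝[≠] (1 : ℂ)) := by
      refine tendsto_nhdsWithin_iff.2 ⟨?_, ?_⟩
      · have := Complex.continuous_ofReal.tendsto 1
        rw [Complex.ofReal_one] at this
        exact this.mono_left nhdsWithin_le_nhds
      · filter_upwards [self_mem_nhdsWithin] with x hx
        have : x ≠ 1 := ne_of_gt hx
        simpa using this
    refine ht.frequently (Eventually.frequently ?_)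
    filter_upwards [self_mem_nhdsWithin] with x hx
    exact hreal x (one_pos.trans hx)
  exact hf.eqOn_of_preconnected_of_frequently_eq hg hUc (z₀ := 1) (by simp [hU]) hfreq hr

/-! ### Convergence of Mainardi's series -/

/-- Log-convexity of $\Gamma$ at $x+q=(1-q)x+q(x+1)$. -/
theorem Real.Gamma_add_le_Gamma_mul_rpow {x q : ℝ} (hx : 0 < x) (hq0 : 0 < q) (hq1 : q < 1) :
    Real.Gamma (x + q) ≤ Real.Gamma x * x ^ q := by
  have h := Real.Gamma_mul_add_mul_le_rpow_Gamma_mul_rpow_Gamma hx (by linarith : 0 < x + 1)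
    (by linarith : 0 < 1 - q) hq0 (by ring)
  have hG := Real.Gamma_pos_of_pos hx
  rw [Real.Gamma_add_one hx.ne', Real.mul_rpow hx.le hG.le] at h
  calc Real.Gamma (x + q) = Real.Gamma ((1 - q) * x + q * (x + 1)) := by ring_nf
    _ ≤ _ := h
    _ = Real.Gamma x ^ (1 - q + q) * x ^ q := by rw [Real.rpow_add hG]; ring
    _ = _ := by simp

/-- Ratio test: consecutive terms have ratio at most $R(n+1)^{q-1}\to0$. This one series dominates
both $M_q$ and its termwise integral representation. -/
theorem summable_pow_mul_Gamma_div_factorial {q : ℝ} (hq0 : 0 < q) (hq1 : q < 1) {R : ℝ}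
    (hR : 0 ≤ R) :
    Summable fun n : ℕ => R ^ n / n.factorial * Real.Gamma (q * ((n : ℝ) + 1)) := by
  refine summable_of_ratio_norm_eventually_le (r := 1 / 2) (by norm_num) ?_
  have hlim : Tendsto (fun n : ℕ => R * ((n : ℝ) + 1) ^ (-(1 - q))) atTop (𝓝 0) := by
    have h1 : Tendsto (fun n : ℕ => ((n : ℝ) + 1)) atTop atTop :=
      tendsto_atTop_add_const_right _ _ tendsto_natCast_atTop_atTop
    simpa using ((tendsto_rpow_neg_atTop (by linarith : 0 < 1 - q)).comp h1).const_mul R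
  filter_upwards [hlim.eventually_le_const (by norm_num : (0 : ℝ) < 1 / 2)] with n hn
  have hn1 : (0 : ℝ) < (n : ℝ) + 1 := by positivity
  have hx : 0 < q * ((n : ℝ) + 1) := by positivity
  have hG := Real.Gamma_pos_of_pos hx
  have hG' : 0 < Real.Gamma (q * (((n + 1 : ℕ) : ℝ) + 1)) := Real.Gamma_pos_of_pos (by positivity)
  rw [Real.norm_of_nonneg (by positivity), Real.norm_of_nonneg (by positivity)]
  have hle : Real.Gamma (q * (((n + 1 : ℕ) : ℝ) + 1)) ≤
      Real.Gamma (q * ((n : ℝ) + 1)) * ((n : ℝ) + 1) ^ q := by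
    have h := Real.Gamma_add_le_Gamma_mul_rpow hx hq0 hq1
    have h2 : (q * ((n : ℝ) + 1)) ^ q ≤ ((n : ℝ) + 1) ^ q := by
      gcongr
      nlinarith
    calc _ = Real.Gamma (q * ((n : ℝ) + 1) + q) := by push_cast; ring_nf
      _ ≤ _ := h
      _ ≤ _ := by gcongr
  have hpow : ((n : ℝ) + 1) ^ (-(1 - q)) = ((n : ℝ) + 1) ^ q / ((n : ℝ) + 1) := by
    rw [neg_sub, Real.rpow_sub_one hn1.ne']
  calc R ^ (n + 1) / ((n + 1).factorial : ℝ) * Real.Gamma (q * (((n + 1 : ℕ) : ℝ) + 1))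
      ≤ R ^ (n + 1) / ((n + 1).factorial : ℝ) *
        (Real.Gamma (q * ((n : ℝ) + 1)) * ((n : ℝ) + 1) ^ q) := by gcongr
    _ = (R * ((n : ℝ) + 1) ^ (-(1 - q))) *
        (R ^ n / n.factorial * Real.Gamma (q * ((n : ℝ) + 1))) := by
      rw [hpow, Nat.factorial_succ]
      push_cast
      field_simp
      ring
    _ ≤ _ := by gcongr

/-- The reflection formula; at the poles both sides are $0$ by the division conventions. -/
theorem Real.inv_Gamma_one_sub {x : ℝ} (hx : 0 < x) :
    (Real.Gamma (1 - x))⁻¹ = Real.Gamma x * Real.sin (Real.pi * x) / Real.pi := by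
  have hG := (Real.Gamma_pos_of_pos hx).ne'
  have h : Real.Gamma (1 - x) = Real.pi / Real.sin (Real.pi * x) / Real.Gamma x := by
    rw [← Real.Gamma_mul_Gamma_one_sub, mul_div_cancel_left₀ _ hG]
  rw [h, inv_div, div_div_eq_mul_div]

theorem mainardiWrightTerm_eq {q : ℝ} (hq : 0 < q) (z : ℝ) (n : ℕ) :
    mainardiWrightTerm q z n = (-z) ^ n / n.factorial * Real.Gamma (q * ((n : ℝ) + 1)) *
      Real.sin (Real.pi * (q * ((n : ℝ) + 1))) / Real.pi := by
  rw [mainardiWrightTerm, ← div_div, div_eq_mul_inv _ (Real.Gamma _),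
    Real.inv_Gamma_one_sub (by positivity)]
  ring

theorem norm_mainardiWrightTerm_le {q : ℝ} (hq : 0 < q) {z R : ℝ} (hz : |z| ≤ R) (n : ℕ) :
    ‖mainardiWrightTerm q z n‖ ≤ R ^ n / n.factorial * Real.Gamma (q * ((n : ℝ) + 1)) := by
  have hG : 0 < Real.Gamma (q * ((n : ℝ) + 1)) := Real.Gamma_pos_of_pos (by positivity)
  have hR : 0 ≤ R := (abs_nonneg z).trans hz
  rw [mainardiWrightTerm_eq hq, mul_div_assoc, norm_mul]
  have h1 : ‖Real.sin (Real.pi * (q * ((n : ℝ) + 1))) / Real.pi‖ ≤ 1 := by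
    rw [norm_div, Real.norm_of_nonneg Real.pi_pos.le, div_le_one Real.pi_pos, Real.norm_eq_abs]
    exact (Real.abs_sin_le_one _).trans (by linarith [Real.pi_gt_three])
  refine (mul_le_of_le_one_right (norm_nonneg _) h1).trans ?_
  rw [norm_mul, norm_div, norm_pow, norm_neg, Real.norm_of_nonneg hG.le, Real.norm_natCast,
    Real.norm_eq_abs]
  gcongr

theorem summable_mainardiWrightTerm {q : ℝ} (hq0 : 0 < q) (hq1 : q < 1) (z : ℝ) :
    Summable (mainardiWrightTerm q z) :=
  Summable.of_norm_bounded (summable_pow_mul_Gamma_div_factorial hq0 hq1 (abs_nonneg z))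
    (norm_mainardiWrightTerm_le hq0 le_rfl)

theorem continuous_mainardiWright {q : ℝ} (hq0 : 0 < q) (hq1 : q < 1) :
    Continuous (mainardiWright q) := by
  refine continuous_iff_continuousAt.2 fun z => ?_
  have h : ContinuousOn (mainardiWright q) (Metric.ball 0 (|z| + 1)) := by
    refine continuousOn_tsum (u := fun n : ℕ =>
      (|z| + 1) ^ n / n.factorial * Real.Gamma (q * ((n : ℝ) + 1))) (fun n => ?_)
      (summable_pow_mul_Gamma_div_factorial hq0 hq1 (by positivity)) fun n x hx => ?_
    · exact Continuous.continuousOn (by unfold mainardiWrightTerm; fun_prop)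
    · exact norm_mainardiWrightTerm_le hq0 (by simpa using (mem_ball_zero_iff.1 hx).le) n
  exact h.continuousAt (Metric.isOpen_ball.mem_nhds (by simp))

/-! ### Integral representation of $M_q$ on a ray -/

theorem integral_rpow_mul_cexp_of_arg {s φ : ℝ} (hs : 0 < s) (hφ0 : 0 < φ)
    (hφ : φ < Real.pi / 2) :
    ∫ t in Ioi (0 : ℝ), ((t ^ (s - 1) : ℝ) : ℂ) *
      Complex.exp (-(Complex.exp (-(φ * Complex.I)) * t)) =
      Complex.exp (φ * s * Complex.I) * (Real.Gamma s : ℂ) := by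
  have hre : 0 < (Complex.exp (-(φ * Complex.I))).re := by
    rw [← neg_mul, ← Complex.ofReal_neg, Complex.exp_ofReal_mul_I_re, Real.cos_neg]
    exact Real.cos_pos_of_mem_Ioo ⟨by linarith, hφ⟩
  rw [integral_rpow_mul_cexp hs hre, Complex.cpow_def_of_ne_zero (Complex.exp_ne_zero _),
    Complex.log_exp]
  · ring_nf
  · simp; linarith
  · simp; linarith

theorem hasSum_pow_mul_rpow_mul_cexp {q t : ℝ} (ht : 0 < t) (θ : ℝ) (b r : ℂ) :
    HasSum (fun n : ℕ => b ^ (n + 1) * ((-θ : ℂ) ^ n / n.factorial) *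
      (((t ^ (q * ((n : ℝ) + 1) - 1) : ℝ) : ℂ) * Complex.exp (-(r * t))))
      (b * Complex.exp (-(θ * b * (t ^ q : ℝ))) *
        (((t ^ (q - 1) : ℝ) : ℂ) * Complex.exp (-(r * t)))) := by
  have h := NormedSpace.expSeries_div_hasSum_exp (-((θ : ℂ) * b * (t ^ q : ℝ)))
  rw [← Complex.exp_eq_exp_ℂ] at h
  convert! (h.mul_left b).mul_right (((t ^ (q - 1) : ℝ) : ℂ) * Complex.exp (-(r * t)))
    using 2 with n
  have hp : t ^ (q * ((n : ℝ) + 1) - 1) = (t ^ q) ^ n * t ^ (q - 1) := by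
    rw [← Real.rpow_natCast (t ^ q), ← Real.rpow_mul ht.le, ← Real.rpow_add ht]
    ring_nf
  rw [hp, Complex.ofReal_mul, Complex.ofReal_pow, mul_assoc (θ : ℂ),
    ← neg_mul (θ : ℂ), mul_pow, mul_pow]
  ring

/-- Mainardi's function as an integral along a ray in the right half plane. -/
theorem pi_mul_mainardiWright {q φ : ℝ} (hq0 : 0 < q) (hq1 : q < 1) (hφ0 : 0 < φ)
    (hφ : φ < Real.pi / 2) (θ : ℝ) :
    Real.pi * mainardiWright q θ = (∫ t in Ioi (0 : ℝ),
      Complex.exp (q * (Real.pi - φ) * Complex.I) *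
        Complex.exp (-(θ * Complex.exp (q * (Real.pi - φ) * Complex.I) * (t ^ q : ℝ))) *
        (((t ^ (q - 1) : ℝ) : ℂ) *
          Complex.exp (-(Complex.exp (-(φ * Complex.I)) * t)))).im := by
  set b : ℂ := Complex.exp (q * (Real.pi - φ) * Complex.I) with hb
  set r : ℂ := Complex.exp (-(φ * Complex.I)) with hr
  have hbn : ‖b‖ = 1 := by
    rw [hb]
    have := Complex.norm_exp_ofReal_mul_I (q * (Real.pi - φ))
    push_cast at this
    exact this
  have hcos : 0 < Real.cos φ := Real.cos_pos_of_mem_Ioo ⟨by linarith, hφ⟩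
  have hre : r.re = Real.cos φ := by
    rw [hr, ← neg_mul, ← Complex.ofReal_neg, Complex.exp_ofReal_mul_I_re, Real.cos_neg]
  have hrpos : 0 < r.re := hre ▸ hcos
  set F : ℕ → ℝ → ℂ := fun n t => b ^ (n + 1) * ((-θ : ℂ) ^ n / n.factorial) *
      (((t ^ (q * ((n : ℝ) + 1) - 1) : ℝ) : ℂ) * Complex.exp (-(r * t))) with hF
  have hspos : ∀ n : ℕ, 0 < q * ((n : ℝ) + 1) := fun n => by positivity
  have hint : ∀ n, IntegrableOn (F n) (Ioi 0) := fun n =>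
    (integrableOn_rpow_mul_cexp (by linarith [hspos n]) hrpos).const_mul _
  have hnorm : ∀ n, ∫ t in Ioi (0 : ℝ), ‖F n t‖ = (1 / r.re) ^ q *
      ((|θ| * (1 / r.re) ^ q) ^ n / n.factorial * Real.Gamma (q * ((n : ℝ) + 1))) := by
    intro n
    have h1 : ∫ t in Ioi (0 : ℝ), ‖F n t‖ = ∫ t in Ioi (0 : ℝ), |θ| ^ n / n.factorial *
        (t ^ (q * ((n : ℝ) + 1) - 1) * Real.exp (-(r.re * t))) := by
      refine setIntegral_congr_fun measurableSet_Ioi fun t ht => ?_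
      simp only [hF]
      rw [norm_mul, norm_rpow_mul_cexp ht, norm_mul, norm_pow, hbn, norm_div, norm_pow, norm_neg,
        Complex.norm_real, Real.norm_eq_abs, Complex.norm_natCast]
      simp
    rw [h1, integral_const_mul, Real.integral_rpow_mul_exp_neg_mul_Ioi (hspos n) hrpos,
      Real.rpow_mul (by positivity), ← Nat.cast_add_one, Real.rpow_natCast, pow_succ, mul_pow]
    ring
  -- Absolute summability justifies exchanging sum and integral.
  have hsum : Summable fun n => ∫ t in Ioi (0 : ℝ), ‖F n t‖ := by
    simp only [hnorm]
    exact (summable_pow_mul_Gamma_div_factorial hq0 hq1 (by positivity)).mul_left _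
  have hS := hasSum_integral_of_summable_integral_norm hint hsum
  have hL : ∫ t in Ioi (0 : ℝ), ∑' n, F n t = ∫ t in Ioi (0 : ℝ),
      b * Complex.exp (-(θ * b * (t ^ q : ℝ))) *
        (((t ^ (q - 1) : ℝ) : ℂ) * Complex.exp (-(r * t))) :=
    setIntegral_congr_fun measurableSet_Ioi fun t ht =>
      (hasSum_pow_mul_rpow_mul_cexp ht θ b r).tsum_eq
  rw [hL] at hS
  -- The phases $q(n+1)(\pi-\varphi)$ and $q(n+1)\varphi$ add up to $\pi q(n+1)$, whose sine is the
  -- factor in the reflection formula.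
  have hI : ∀ n, (∫ t in Ioi (0 : ℝ), F n t).im = Real.pi * mainardiWrightTerm q θ n := by
    intro n
    simp only [hF]
    rw [integral_const_mul, hr, integral_rpow_mul_cexp_of_arg (hspos n) hφ0 hφ, hb,
      ← Complex.exp_nat_mul, mainardiWrightTerm_eq hq0]
    have h2 : Complex.exp (((n + 1 : ℕ) : ℂ) * (q * (Real.pi - φ) * Complex.I)) *
        ((-θ : ℂ) ^ n / n.factorial) *
        (Complex.exp (φ * (q * ((n : ℝ) + 1) : ℝ) * Complex.I) *
          (Real.Gamma (q * ((n : ℝ) + 1)) : ℂ)) =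
        (((-θ) ^ n / n.factorial * Real.Gamma (q * ((n : ℝ) + 1)) : ℝ) : ℂ) *
          Complex.exp ((Real.pi * (q * ((n : ℝ) + 1)) : ℝ) * Complex.I) := by
      have h3 : Complex.exp ((Real.pi * (q * ((n : ℝ) + 1)) : ℝ) * Complex.I) =
          Complex.exp (((n + 1 : ℕ) : ℂ) * (q * (Real.pi - φ) * Complex.I)) *
          Complex.exp (φ * (q * ((n : ℝ) + 1) : ℝ) * Complex.I) := by
        rw [← Complex.exp_add]
        push_cast
        ring_nf
      rw [h3]
      push_cast
      ring
    rw [h2, Complex.im_ofReal_mul, Complex.exp_ofReal_mul_I_im]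
    field_simp
  have him := Complex.hasSum_im hS
  simp only [hI] at him
  rw [← him.tsum_eq, tsum_mul_left]
  rfl

/-! ### Decay of $M_q$ and its second moment -/

theorem Complex.norm_exp_sub_one_sub_id_le_of_re_nonpos {z : ℂ} (hz : z.re ≤ 0) :
    ‖Complex.exp z - 1 - z‖ ≤ 3 * ‖z‖ ^ 2 := by
  rcases le_total ‖z‖ 1 with h | h
  · linarith [Complex.norm_exp_sub_one_sub_id_le h, sq_nonneg ‖z‖]
  · have h1 : ‖Complex.exp z‖ ≤ 1 := by
      rw [Complex.norm_exp]
      exact Real.exp_le_one_iff.2 hz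
    have h2 : ‖Complex.exp z - 1 - z‖ ≤ ‖Complex.exp z‖ + ‖(1 : ℂ)‖ + ‖z‖ :=
      (norm_sub_le _ _).trans (by gcongr; exact norm_sub_le _ _)
    rw [norm_one] at h2
    nlinarith

theorem norm_rpow_mul_cexp_rpow {t : ℝ} (ht : 0 < t) (s p : ℝ) (z : ℂ) :
    ‖((t ^ s : ℝ) : ℂ) * Complex.exp (-(z * (t ^ p : ℝ)))‖ =
      t ^ s * Real.exp (-z.re * t ^ p) := by
  rw [norm_mul, Complex.norm_real, Real.norm_of_nonneg (by positivity), Complex.norm_exp]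
  simp

theorem continuousOn_rpow_mul_cexp_rpow (s p : ℝ) (z : ℂ) :
    ContinuousOn (fun t : ℝ => ((t ^ s : ℝ) : ℂ) * Complex.exp (-(z * (t ^ p : ℝ)))) (Ioi 0) := by
  have h : ∀ s : ℝ, ContinuousOn (fun t : ℝ => ((t ^ s : ℝ) : ℂ)) (Ioi 0) := fun s =>
    Complex.continuous_ofReal.comp_continuousOn
      (continuousOn_id.rpow_const fun t ht => Or.inl (ne_of_gt ht))
  exact (h s).mul (continuousOn_const.mul (h p)).neg.cexp

theorem integrableOn_rpow_mul_cexp_rpow {s p : ℝ} {z : ℂ} (hs : -1 < s) (hp : 0 < p)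
    (hz : 0 < z.re) :
    IntegrableOn (fun t : ℝ => ((t ^ s : ℝ) : ℂ) * Complex.exp (-(z * (t ^ p : ℝ)))) (Ioi 0) := by
  refine Integrable.mono' (integrableOn_rpow_mul_exp_neg_mul_rpow hs hp hz)
    ((continuousOn_rpow_mul_cexp_rpow s p z).aestronglyMeasurable measurableSet_Ioi) ?_
  filter_upwards [ae_restrict_mem measurableSet_Ioi] with t ht
  exact (norm_rpow_mul_cexp_rpow ht s p z).le

/-- The substitution $x=t^p$ reduces this to Euler's integral. -/
theorem integral_rpow_mul_cexp_rpow {s p : ℝ} {z : ℂ} (hs : -1 < s) (hp : 0 < p)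
    (hz : 0 < z.re) :
    ∫ t in Ioi (0 : ℝ), ((t ^ s : ℝ) : ℂ) * Complex.exp (-(z * (t ^ p : ℝ))) =
      ((p⁻¹ * Real.Gamma ((s + 1) / p) : ℝ) : ℂ) * z ^ (-((s + 1) / p : ℝ) : ℂ) := by
  have hs' : 0 < (s + 1) / p := div_pos (by linarith) hp
  have h1 := integral_comp_rpow_Ioi_of_pos (p := p) (g := fun x : ℝ => ((p⁻¹ : ℝ) : ℂ) *
    (((x ^ ((s + 1) / p - 1) : ℝ) : ℂ) * Complex.exp (-(z * x)))) hp
  rw [integral_const_mul, integral_rpow_mul_cexp hs' hz] at h1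
  rw [Complex.ofReal_mul, mul_right_comm, mul_assoc, ← h1]
  refine setIntegral_congr_fun measurableSet_Ioi fun t ht => ?_
  have ht : 0 < t := ht
  have h2 : (p * t ^ (p - 1)) * (p⁻¹ * (t ^ p) ^ ((s + 1) / p - 1)) = t ^ s := by
    rw [← Real.rpow_mul ht.le, mul_mul_mul_comm, mul_inv_cancel₀ hp.ne', one_mul,
      ← Real.rpow_add ht]
    congr 1
    field_simp
    ring
  simp only [Complex.real_smul]
  rw [← h2]
  push_cast
  ring

section

variable {q β θ : ℝ}

theorem re_mul_cexp_mul_I (θ x : ℝ) :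
    ((θ : ℂ) * Complex.exp (x * Complex.I)).re = θ * Real.cos x := by
  rw [Complex.re_ofReal_mul, Complex.exp_ofReal_mul_I_re]

theorem integrableOn_ray_moment (hq : 0 < q) (hcos : 0 < Real.cos (q * β)) (hθ : 0 < θ) (k : ℕ) :
    IntegrableOn (fun t : ℝ => Complex.exp ((q * β : ℝ) * Complex.I) *
      Complex.exp (-(θ * Complex.exp ((q * β : ℝ) * Complex.I) * (t ^ q : ℝ))) *
      (((t ^ (q - 1) : ℝ) : ℂ) * (Complex.exp (β * Complex.I) * t) ^ k)) (Ioi 0) := by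
  set z : ℂ := θ * Complex.exp ((q * β : ℝ) * Complex.I) with hz
  have hzre : 0 < z.re := by rw [hz, re_mul_cexp_mul_I]; positivity
  have h := (integrableOn_rpow_mul_cexp_rpow (s := q - 1 + k) (by
    have : (0 : ℝ) ≤ k := k.cast_nonneg
    linarith) hq hzre).const_mul
    (Complex.exp ((q * β : ℝ) * Complex.I) * Complex.exp (β * Complex.I) ^ k)
  refine h.congr ?_
  filter_upwards [ae_restrict_mem measurableSet_Ioi] with t ht
  have ht : 0 < t := ht
  rw [Real.rpow_add ht, Real.rpow_natCast]
  push_cast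
  ring

/-- With $w=e^{i\beta}t$ this is $\int w^{q-1+k}e^{-\theta w^q}\,dw$, whose value does not depend on
the ray and is real. -/
theorem im_integral_ray_moment (hq : 0 < q) (hcos : 0 < Real.cos (q * β))
    (hβ0 : -Real.pi < q * β) (hβ : q * β ≤ Real.pi) (hθ : 0 < θ) (k : ℕ) :
    (∫ t in Ioi (0 : ℝ), Complex.exp ((q * β : ℝ) * Complex.I) *
      Complex.exp (-(θ * Complex.exp ((q * β : ℝ) * Complex.I) * (t ^ q : ℝ))) *
      (((t ^ (q - 1) : ℝ) : ℂ) * (Complex.exp (β * Complex.I) * t) ^ k)).im = 0 := by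
  set z : ℂ := θ * Complex.exp ((q * β : ℝ) * Complex.I) with hz
  have hzre : 0 < z.re := by rw [hz, re_mul_cexp_mul_I]; positivity
  have hk : (0 : ℝ) ≤ k := k.cast_nonneg
  have h : ∫ t in Ioi (0 : ℝ), Complex.exp ((q * β : ℝ) * Complex.I) *
      Complex.exp (-(z * (t ^ q : ℝ))) *
      (((t ^ (q - 1) : ℝ) : ℂ) * (Complex.exp (β * Complex.I) * t) ^ k) =
      (Complex.exp ((q * β : ℝ) * Complex.I) * Complex.exp (β * Complex.I) ^ k) *
      ∫ t in Ioi (0 : ℝ), ((t ^ (q - 1 + k) : ℝ) : ℂ) * Complex.exp (-(z * (t ^ q : ℝ))) := by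
    rw [← integral_const_mul]
    refine setIntegral_congr_fun measurableSet_Ioi fun t ht => ?_
    have ht : 0 < t := ht
    rw [Real.rpow_add ht, Real.rpow_natCast]
    push_cast
    ring
  -- Since $q\beta\in(-\pi,\pi]$, this exponent is the principal logarithm of $z$.
  have hzexp : z = Complex.exp ((Real.log θ : ℂ) + (q * β : ℝ) * Complex.I) := by
    rw [Complex.exp_add, ← Complex.ofReal_exp, Real.exp_log hθ]
  have hpow : z ^ (-((q - 1 + k + 1) / q : ℝ) : ℂ) =
      ((Real.exp (Real.log θ * -((q + k) / q)) : ℝ) : ℂ) *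
        Complex.exp (-((q + k) * β) * Complex.I) := by
    rw [Complex.cpow_def_of_ne_zero (by rw [hzexp]; exact Complex.exp_ne_zero _), hzexp,
      Complex.log_exp (by simpa using hβ0) (by simpa using hβ), Complex.ofReal_exp,
      ← Complex.exp_add]
    congr 1
    have : (q : ℂ) ≠ 0 := by exact_mod_cast hq.ne'
    push_cast
    field_simp
    ring
  have hone : Complex.exp ((q * β : ℝ) * Complex.I) * Complex.exp (β * Complex.I) ^ k *
      Complex.exp (-((q + k) * β) * Complex.I) = 1 := by
    rw [← Complex.exp_nat_mul, ← Complex.exp_add, ← Complex.exp_add, ← Complex.exp_zero]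
    congr 1
    push_cast
    ring
  rw [h, integral_rpow_mul_cexp_rpow (by linarith) hq hzre, hpow]
  have : ∀ x y : ℝ, Complex.exp ((q * β : ℝ) * Complex.I) * Complex.exp (β * Complex.I) ^ k *
      ((x : ℂ) * ((y : ℂ) * Complex.exp (-((q + k) * β) * Complex.I))) = ((x * y : ℝ) : ℂ) := by
    intro x y
    rw [Complex.ofReal_mul x y]
    linear_combination (x * y : ℂ) * hone
  rw [this, Complex.ofReal_im]

end

/-- The representation is taken with $\varphi=\pi-\beta$, so that $-e^{-i\varphi}=e^{i\beta}$ has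
negative real part while $e^{iq\beta}$ has positive real part. -/
theorem abs_mainardiWright_le_of_angle {q β θ : ℝ} (hq0 : 0 < q) (hq1 : q < 1)
    (hβ : Real.pi / 2 < β) (hβ' : β < Real.pi) (hqβ : q * β < Real.pi / 2) (hθ : 0 < θ) :
    |mainardiWright q θ| ≤ 3 / Real.pi *
      ((θ * Real.cos (q * β)) ^ (-(q + 1 + 1) / q) * (1 / q) * Real.Gamma ((q + 1 + 1) / q)) := by
  have hqβ0 : 0 < q * β := by
    have := Real.pi_pos
    exact mul_pos hq0 (by linarith)
  have hcos : 0 < Real.cos (q * β) := Real.cos_pos_of_mem_Ioo ⟨by linarith, hqβ⟩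
  have hrep := pi_mul_mainardiWright hq0 hq1 (φ := Real.pi - β) (by linarith) (by linarith) θ
  have hrot : -Complex.exp (-(((Real.pi - β : ℝ) : ℂ) * Complex.I)) =
      Complex.exp (β * Complex.I) := by
    rw [Complex.ofReal_sub, sub_mul, neg_sub, Complex.exp_sub, Complex.exp_pi_mul_I,
      div_neg, div_one, neg_neg]
  have hq' : Complex.exp (q * (Real.pi - ((Real.pi - β : ℝ) : ℂ)) * Complex.I) =
      Complex.exp ((q * β : ℝ) * Complex.I) := by
    push_cast
    ring_nf
  rw [hq'] at hrep
  set b : ℂ := Complex.exp ((q * β : ℝ) * Complex.I) with hb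
  set a : ℂ := Complex.exp (β * Complex.I) with ha
  simp only [← neg_mul] at hrep hrot
  rw [hrot] at hrep
  have hb1 : ‖b‖ = 1 := Complex.norm_exp_ofReal_mul_I _
  have ha1 : ‖a‖ = 1 := Complex.norm_exp_ofReal_mul_I _
  have hare : a.re < 0 := by
    rw [ha, Complex.exp_ofReal_mul_I_re]
    exact Real.cos_neg_of_pi_div_two_lt_of_lt hβ (by linarith)
  have hzre : ((θ : ℂ) * b).re = θ * Real.cos (q * β) := re_mul_cexp_mul_I θ _
  have hc : 0 < θ * Real.cos (q * β) := by positivity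
  have hi0 := integrableOn_ray_moment hq0 hcos hθ 0
  have hi1 := integrableOn_ray_moment hq0 hcos hθ 1
  have hm0 := im_integral_ray_moment hq0 hcos (by linarith) (by linarith) hθ 0
  have hm1 := im_integral_ray_moment hq0 hcos (by linarith) (by linarith) hθ 1
  rw [← hb, ← ha] at hi0 hi1 hm0 hm1
  simp only [← neg_mul] at hi0 hi1 hm0 hm1
  have hbase : ∀ t : ℝ, 0 < t →
      ‖b * Complex.exp (-θ * b * (t ^ q : ℝ)) * ((t ^ (q - 1) : ℝ) : ℂ)‖ =
        t ^ (q - 1) * Real.exp (-(θ * Real.cos (q * β)) * t ^ q) := by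
    intro t ht
    rw [norm_mul, norm_mul, hb1, one_mul, ← norm_mul, mul_comm, ← hzre, neg_mul, neg_mul,
      norm_rpow_mul_cexp_rpow ht]
  have hiM : IntegrableOn (fun t : ℝ => b * Complex.exp (-θ * b * (t ^ q : ℝ)) *
      (((t ^ (q - 1) : ℝ) : ℂ) * Complex.exp (a * t))) (Ioi 0) := by
    have h1 : IntegrableOn (fun t : ℝ => (b * Complex.exp (-θ * b * (t ^ q : ℝ)) *
      ((t ^ (q - 1) : ℝ) : ℂ)) * Complex.exp (a * t)) (Ioi 0) := by
      refine Integrable.mul_bdd (c := 1) (by simpa [IntegrableOn] using hi0) ?_ ?_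
      · exact (by fun_prop : Continuous fun t : ℝ => Complex.exp (a * t)).aestronglyMeasurable
      · filter_upwards [ae_restrict_mem measurableSet_Ioi] with t ht
        rw [Complex.norm_exp, Real.exp_le_one_iff, Complex.re_mul_ofReal]
        exact mul_nonpos_of_nonpos_of_nonneg hare.le (le_of_lt ht)
    simpa only [mul_assoc] using h1
  -- Two Taylor terms are removed because one would give only $\theta^{-(q+1)/q}$, too slow for a
  -- second moment when $q>1/2$.
  have hrem : Real.pi * mainardiWright q θ = (∫ t in Ioi (0 : ℝ),
      b * Complex.exp (-θ * b * (t ^ q : ℝ)) * ((t ^ (q - 1) : ℝ) : ℂ) *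
        (Complex.exp (a * t) - 1 - a * t)).im := by
    have h1 : ∀ t : ℝ, b * Complex.exp (-θ * b * (t ^ q : ℝ)) * ((t ^ (q - 1) : ℝ) : ℂ) *
        (Complex.exp (a * t) - 1 - a * t) =
        b * Complex.exp (-θ * b * (t ^ q : ℝ)) *
          (((t ^ (q - 1) : ℝ) : ℂ) * Complex.exp (a * t)) -
        b * Complex.exp (-θ * b * (t ^ q : ℝ)) * (((t ^ (q - 1) : ℝ) : ℂ) * (a * t) ^ 0) -
        b * Complex.exp (-θ * b * (t ^ q : ℝ)) * (((t ^ (q - 1) : ℝ) : ℂ) * (a * t) ^ 1) := by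
      intro t
      ring
    simp only [h1]
    have h2 := integral_sub (hiM.sub hi0) hi1
    simp only [Pi.sub_apply] at h2
    rw [h2, integral_sub hiM hi0, Complex.sub_im, Complex.sub_im,
      hm0, hm1, sub_zero, sub_zero, hrep]
  have hs : -1 < q + 1 := by linarith
  have hbound : |Real.pi * mainardiWright q θ| ≤ ∫ t in Ioi (0 : ℝ),
      3 * (t ^ (q + 1) * Real.exp (-(θ * Real.cos (q * β)) * t ^ q)) := by
    rw [hrem]
    refine (Complex.abs_im_le_norm _).trans (norm_integral_le_of_norm_le
      ((integrableOn_rpow_mul_exp_neg_mul_rpow hs hq0 hc).const_mul 3) ?_)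
    filter_upwards [ae_restrict_mem measurableSet_Ioi] with t ht
    have ht : 0 < t := ht
    have h2 : ‖Complex.exp (a * t) - 1 - a * t‖ ≤ 3 * t ^ 2 := by
      have := Complex.norm_exp_sub_one_sub_id_le_of_re_nonpos (z := a * t) (by
        rw [Complex.re_mul_ofReal]
        exact mul_nonpos_of_nonpos_of_nonneg hare.le ht.le)
      rwa [norm_mul, ha1, one_mul, Complex.norm_real, Real.norm_of_nonneg ht.le] at this
    have h3 : t ^ (q + 1) = t ^ (q - 1) * t ^ 2 := by
      rw [← Real.rpow_natCast, ← Real.rpow_add ht]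
      congr 1
      push_cast
      ring
    rw [norm_mul, hbase t ht, h3]
    calc _ ≤ t ^ (q - 1) * Real.exp (-(θ * Real.cos (q * β)) * t ^ q) * (3 * t ^ 2) := by gcongr
      _ = _ := by ring
  rw [integral_const_mul, integral_rpow_mul_exp_neg_mul_rpow hq0 hs hc, abs_mul,
    abs_of_pos Real.pi_pos] at hbound
  rw [div_mul_eq_mul_div, le_div_iff₀ Real.pi_pos, mul_comm]
  exact hbound

theorem exists_abs_mainardiWright_le {q : ℝ} (hq0 : 1 / 2 < q) (hq1 : q < 1) :
    ∃ A : ℝ, ∀ θ : ℝ, 0 < θ → |mainardiWright q θ| ≤ A * θ ^ (-(q + 2) / q) := by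
  have hq : 0 < q := by linarith
  have hpi := Real.pi_pos
  -- The midpoint of $\pi/2$ and $\pi/(2q)$.
  set β := Real.pi * (q + 1) / (4 * q) with hβ
  have hqβ : q * β = Real.pi * (q + 1) / 4 := by rw [hβ]; field_simp
  have h1 : Real.pi / 2 < β := by
    rw [hβ, div_lt_div_iff₀ (by norm_num) (by positivity)]
    nlinarith
  have h2 : β < Real.pi := by
    rw [hβ, div_lt_iff₀ (by positivity)]
    nlinarith
  have h3 : q * β < Real.pi / 2 := by rw [hqβ]; nlinarith
  have h4 : 0 < q * β := by rw [hqβ]; positivity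
  have hcos : 0 < Real.cos (q * β) := Real.cos_pos_of_mem_Ioo ⟨by linarith, h3⟩
  refine ⟨3 / Real.pi * (Real.cos (q * β) ^ (-(q + 2) / q) * (1 / q) *
    Real.Gamma ((q + 2) / q)), fun θ hθ => ?_⟩
  refine (abs_mainardiWright_le_of_angle hq hq1 h1 h2 h3 hθ).trans_eq ?_
  rw [show q + 1 + 1 = q + 2 by ring, Real.mul_rpow hθ.le hcos.le]
  ring

theorem integrableOn_sq_mul_mainardiWright {q : ℝ} (hq0 : 1 / 2 < q) (hq1 : q < 1) :
    IntegrableOn (fun θ : ℝ => θ ^ 2 * mainardiWright q θ) (Ioi 0) := by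
  have hq : 0 < q := by linarith
  have hcont : Continuous fun θ : ℝ => θ ^ 2 * mainardiWright q θ :=
    (continuous_pow 2).mul (continuous_mainardiWright hq hq1)
  obtain ⟨A, hA⟩ := exists_abs_mainardiWright_le hq0 hq1
  rw [← Ioc_union_Ioi_eq_Ioi (zero_le_one' ℝ)]
  refine IntegrableOn.union (hcont.integrableOn_Icc.mono_set Ioc_subset_Icc_self) ?_
  -- Equivalent to $q<1$.
  have hexp : 2 + -(q + 2) / q < -1 := by
    rw [← sub_neg, show 2 + -(q + 2) / q - -1 = (2 * q - 2) / q by field_simp; ring]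
    exact div_neg_of_neg_of_pos (by linarith) hq
  refine Integrable.mono' ((integrableOn_Ioi_rpow_of_lt hexp one_pos).const_mul A)
    hcont.aestronglyMeasurable ?_
  filter_upwards [ae_restrict_mem measurableSet_Ioi] with θ hθ
  have hθ : 0 < θ := one_pos.trans hθ
  rw [norm_mul, norm_pow, Real.norm_of_nonneg hθ.le, Real.norm_eq_abs, Real.rpow_add hθ,
    Real.rpow_two]
  calc _ ≤ θ ^ 2 * (A * θ ^ (-(q + 2) / q)) := by gcongr; exact hA θ hθ
    _ = _ := by ring

/-! ### Lipschitz bounds for $S$ and $P_q^\psi$ -/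

section

variable {𝕜 X : Type*} [RCLike 𝕜] [NormedAddCommGroup X] [NormedSpace ℝ X] [NormedSpace 𝕜 X]
  {C : ℝ → X →L[𝕜] X} {K q : ℝ}

theorem norm_sineFamily_sub_le (hC : IsCosineFamily C) (hCK : ∀ t : ℝ, ‖C t‖ ≤ K) (x : X)
    (a b : ℝ) : ‖sineFamily C a x - sineFamily C b x‖ ≤ K * ‖x‖ * |a - b| := by
  have hi : ∀ a b : ℝ, IntervalIntegrable (fun r => C r x) volume a b := fun a b =>
    (hC.continuous_apply x).intervalIntegrable a b
  rw [sineFamily, sineFamily, intervalIntegral.integral_interval_sub_left (hi _ _) (hi _ _)]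
  exact intervalIntegral.norm_integral_le_of_norm_le_const fun r _ => (C r).le_of_opNorm_le (hCK r) x

theorem sineFamily_zero (C : ℝ → X →L[𝕜] X) (x : X) : sineFamily C 0 x = 0 :=
  intervalIntegral.integral_same

theorem continuous_sineFamily (hC : IsCosineFamily C) (hCK : ∀ t : ℝ, ‖C t‖ ≤ K) (x : X) :
    Continuous fun t => sineFamily C t x := by
  have hK : 0 ≤ K := (norm_nonneg _).trans (hCK 0)
  refine (LipschitzWith.of_dist_le_mul (K := (K * ‖x‖).toNNReal) fun a b => ?_).continuous
  rw [dist_eq_norm, Real.dist_eq, Real.coe_toNNReal _ (by positivity)]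
  exact norm_sineFamily_sub_le hC hCK x a b

/-- One factor $\theta$ is the weight and the other comes from the Lipschitz bound for $S$, hence
the second moment. -/
theorem norm_psiSineIntegrand_sub_le (hC : IsCosineFamily C) (hCK : ∀ t : ℝ, ‖C t‖ ≤ K)
    (hq : 0 < q) (ψ : ℝ → ℝ) (t s t' s' : ℝ) (x : X) {θ : ℝ} (hθ : 0 < θ) :
    ‖psiSineIntegrand C ψ q t s x θ - psiSineIntegrand C ψ q t' s' x θ‖ ≤
      q * (K * ‖x‖) * |(ψ t - ψ s) ^ q - (ψ t' - ψ s') ^ q| *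
        ‖θ ^ 2 * mainardiWright q θ‖ := by
  rw [psiSineIntegrand, psiSineIntegrand, ← smul_sub, norm_smul, norm_mul, norm_mul,
    Real.norm_of_nonneg hq.le, Real.norm_of_nonneg hθ.le]
  have h := norm_sineFamily_sub_le hC hCK x ((ψ t - ψ s) ^ q * θ) ((ψ t' - ψ s') ^ q * θ)
  rw [← sub_mul, abs_mul, abs_of_pos hθ] at h
  calc _ ≤ q * θ * ‖mainardiWright q θ‖ *
        (K * ‖x‖ * (|(ψ t - ψ s) ^ q - (ψ t' - ψ s') ^ q| * θ)) := by gcongr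
    _ = _ := by
      rw [norm_mul, norm_pow, Real.norm_of_nonneg hθ.le]
      ring

theorem psiSineIntegrand_self (C : ℝ → X →L[𝕜] X) (ψ : ℝ → ℝ) (hq : q ≠ 0) (s : ℝ) (x : X)
    (θ : ℝ) : psiSineIntegrand C ψ q s s x θ = 0 := by
  rw [psiSineIntegrand, sub_self, Real.zero_rpow hq, zero_mul, sineFamily_zero, smul_zero]

theorem integrableOn_psiSineIntegrand (hC : IsCosineFamily C) (hCK : ∀ t : ℝ, ‖C t‖ ≤ K)
    (hq0 : 1 / 2 < q) (hq1 : q < 1) (ψ : ℝ → ℝ) (t s : ℝ) (x : X) :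
    IntegrableOn (psiSineIntegrand C ψ q t s x) (Ioi 0) := by
  have hq : 0 < q := by linarith
  refine Integrable.mono' ((integrableOn_sq_mul_mainardiWright hq0 hq1).norm.const_mul
    (q * (K * ‖x‖) * |(ψ t - ψ s) ^ q - (ψ s - ψ s) ^ q|)) ?_ ?_
  · refine Continuous.aestronglyMeasurable ?_
    exact ((by fun_prop : Continuous fun θ : ℝ => q * θ).mul
      (continuous_mainardiWright hq hq1)).smul
      ((continuous_sineFamily hC hCK x).comp (continuous_const.mul continuous_id))
  · filter_upwards [ae_restrict_mem measurableSet_Ioi] with θ hθ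
    have h := norm_psiSineIntegrand_sub_le hC hCK hq ψ t s s s x hθ
    rwa [psiSineIntegrand_self C ψ hq.ne', sub_zero] at h

theorem psiSineOperator_self (C : ℝ → X →L[𝕜] X) (ψ : ℝ → ℝ) (hq : q ≠ 0) (s : ℝ) (x : X) :
    psiSineOperator C ψ q s s x = 0 := by
  unfold psiSineOperator
  split_ifs
  · rw [sub_self, sineFamily_zero]
  · simp [psiSineIntegrand_self C ψ hq]

theorem exists_norm_psiSineOperator_sub_le (hC : IsCosineFamily C) (hCK : ∀ t : ℝ, ‖C t‖ ≤ K)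
    (hq0 : 1 / 2 < q) (hq1 : q ≤ 1) (ψ : ℝ → ℝ) (x : X) :
    ∃ L : ℝ, ∀ t s t' s' : ℝ,
      ‖psiSineOperator C ψ q t s x - psiSineOperator C ψ q t' s' x‖ ≤
        L * |(ψ t - ψ s) ^ q - (ψ t' - ψ s') ^ q| := by
  rcases hq1.eq_or_lt with rfl | hq1
  · refine ⟨K * ‖x‖, fun t s t' s' => ?_⟩
    simpa [psiSineOperator] using norm_sineFamily_sub_le hC hCK x (ψ t - ψ s) (ψ t' - ψ s')
  · refine ⟨q * (K * ‖x‖) * ∫ θ in Ioi (0 : ℝ), ‖θ ^ 2 * mainardiWright q θ‖,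
      fun t s t' s' => ?_⟩
    rw [psiSineOperator, psiSineOperator, if_neg hq1.ne, if_neg hq1.ne,
      ← integral_sub (integrableOn_psiSineIntegrand hC hCK hq0 hq1 ψ t s x)
        (integrableOn_psiSineIntegrand hC hCK hq0 hq1 ψ t' s' x),
      mul_right_comm, ← integral_const_mul]
    refine norm_integral_le_of_norm_le
      ((integrableOn_sq_mul_mainardiWright hq0 hq1).norm.const_mul _) ?_
    filter_upwards [ae_restrict_mem measurableSet_Ioi] with θ hθ
    exact norm_psiSineIntegrand_sub_le hC hCK (by linarith) ψ t s t' s' x hθ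

/-- Away from $0$ this is continuity of a product; at $0$ the bound $Lz^{2q-1}$ beats the singular
factor. -/
theorem continuousOn_rpow_smul_psiSineOperator_id (hC : IsCosineFamily C)
    (hCK : ∀ t : ℝ, ‖C t‖ ≤ K) (hq0 : 1 / 2 < q) (hq1 : q ≤ 1) (x : X) :
    ContinuousOn (fun z : ℝ => z ^ (q - 1) • psiSineOperator C id q z 0 x) (Ici 0) := by
  have hq : 0 < q := by linarith
  obtain ⟨L, hL⟩ := exists_norm_psiSineOperator_sub_le hC hCK hq0 hq1 id x
  simp only [id] at hL
  intro z hz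
  rcases (mem_Ici.1 hz).eq_or_lt with rfl | hz
  · rw [ContinuousWithinAt, psiSineOperator_self C id hq.ne', smul_zero]
    have hlim : Tendsto (fun z : ℝ => L * z ^ (2 * q - 1)) (𝓝[≥] 0) (𝓝 0) := by
      have := ((Real.continuousAt_rpow_const 0 (2 * q - 1) (Or.inr (by linarith))).tendsto).const_mul L
      rw [Real.zero_rpow (by linarith), mul_zero] at this
      exact this.mono_left nhdsWithin_le_nhds
    refine squeeze_zero_norm' ?_ hlim
    filter_upwards [self_mem_nhdsWithin] with z hz
    rcases (mem_Ici.1 hz).eq_or_lt with rfl | hz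
    · simp [psiSineOperator_self C id hq.ne', Real.zero_rpow (by linarith : 2 * q - 1 ≠ 0)]
    · have h := hL z 0 0 0
      rw [psiSineOperator_self C id hq.ne', sub_zero, sub_zero, sub_zero, Real.zero_rpow hq.ne',
        sub_zero, abs_of_nonneg (by positivity)] at h
      rw [norm_smul, Real.norm_of_nonneg (by positivity)]
      calc _ ≤ z ^ (q - 1) * (L * z ^ q) := by gcongr
        _ = L * (z ^ (q - 1) * z ^ q) := by ring
        _ = _ := by rw [← Real.rpow_add hz]; ring_nf
  · refine ContinuousAt.continuousWithinAt ?_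
    refine (Real.continuousAt_rpow_const z _ (Or.inl hz.ne')).smul ?_
    refine tendsto_iff_norm_sub_tendsto_zero.2 ?_
    have hlim : Tendsto (fun y : ℝ => L * |y ^ q - z ^ q|) (𝓝 z) (𝓝 0) := by
      have := ((((Real.continuousAt_rpow_const z q (Or.inl hz.ne')).sub
        (continuousAt_const (y := z ^ q))).abs).const_mul L).tendsto
      simpa using this
    exact squeeze_zero (fun _ => norm_nonneg _) (fun y => by simpa using hL y 0 z 0) hlim

/-- Reduces every $\psi$ and $s$ to a single function of the increment, which makes the modulus of
continuity uniform in $s$. -/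
theorem psiSineOperator_eq_id (C : ℝ → X →L[𝕜] X) (ψ : ℝ → ℝ) (q t s : ℝ) (x : X) :
    psiSineOperator C ψ q t s x = psiSineOperator C id q (ψ t - ψ s) 0 x := by
  simp [psiSineOperator, psiSineIntegrand, id]

end

/-! ### The limit and uniform continuity -/

theorem proposition3p3 {𝕜 X : Type*} [RCLike 𝕜] [NormedAddCommGroup X] [NormedSpace ℝ X]
    [NormedSpace 𝕜 X] [IsScalarTower ℝ 𝕜 X] [CompleteSpace X]
    (C : ℝ → X →L[𝕜] X) (hC : IsCosineFamily C)
    (K : ℝ) (hK : 1 ≤ K) (hCK : ∀ t : ℝ, ‖C t‖ ≤ K)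
    (T : ℝ) (hT : 0 < T)
    (ψ : ℝ → ℝ) (hψ : ContDiffOn ℝ 1 ψ (Icc 0 T)) (hψmono : StrictMonoOn ψ (Icc 0 T))
    (α q : ℝ) (hα : 1 < α) (hα' : α ≤ 2) (hq : q = α / 2)
    (u : X) :
    -- for `q < 1`, the series of `M_q` and the integral defining `P_q^ψ(t,s)u` converge absolutely
    (q < 1 →
      (∀ θ : ℝ, 0 ≤ θ → Summable (mainardiWrightTerm q θ)) ∧
      ∀ s t : ℝ, 0 ≤ s → s ≤ t → t ≤ T →
        IntegrableOn (psiSineIntegrand C ψ q t s u) (Ioi 0)) ∧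
    -- the limit as `t₁` tends to `s`
    (∀ s : ℝ, 0 ≤ s → s ≤ T →
      Tendsto (fun t₁ : ℝ => (ψ t₁ - ψ s) ^ (q - 1) • psiSineOperator C ψ q t₁ s u)
        (𝓝[Ioc s T] s) (𝓝 0)) ∧
    -- continuity; at `t₁ = s` the expression takes the value `0`
    (∀ ε : ℝ, 0 < ε → ∃ δ : ℝ, 0 < δ ∧
      ∀ s t₁ t₂ : ℝ, 0 ≤ s → s ≤ t₁ → t₁ ≤ t₂ → t₂ ≤ T → t₂ - t₁ < δ →
        ‖(ψ t₂ - ψ s) ^ (q - 1) • psiSineOperator C ψ q t₂ s u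
          - (ψ t₁ - ψ s) ^ (q - 1) • psiSineOperator C ψ q t₁ s u‖ < ε) := by
  have hq0 : 1 / 2 < q := by linarith
  have hq1 : q ≤ 1 := by linarith
  have hf := continuousOn_rpow_smul_psiSineOperator_id hC hCK hq0 hq1 u
  have hmono := hψmono.monotoneOn
  have hψc := hψ.continuousOn
  refine ⟨fun hq1 => ⟨fun θ _ => summable_mainardiWrightTerm (by linarith) hq1 θ,
    fun s t _ _ _ => integrableOn_psiSineIntegrand hC hCK hq0 hq1 ψ t s u⟩,
    fun s hs hsT => ?_, fun ε hε => ?_⟩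
  · simp only [psiSineOperator_eq_id C ψ q _ s u]
    have h0 := hf 0 self_mem_Ici
    rw [ContinuousWithinAt, psiSineOperator_self C id (by linarith), smul_zero] at h0
    refine h0.comp (tendsto_nhdsWithin_iff.2 ⟨?_, ?_⟩)
    · have h1 := ((hψc s ⟨hs, hsT⟩).mono
        (Ioc_subset_Icc_self.trans (Icc_subset_Icc_left hs))).tendsto.sub_const (ψ s)
      rwa [sub_self] at h1
    · filter_upwards [self_mem_nhdsWithin] with t ht
      exact sub_nonneg.2 (hmono ⟨hs, hsT⟩ ⟨hs.trans ht.1.le, ht.2⟩ ht.1.le)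
  · simp only [psiSineOperator_eq_id C ψ q _ _ u]
    have hfu := isCompact_Icc.uniformContinuousOn_of_continuous
      (hf.mono (Icc_subset_Ici_self : Icc 0 (ψ T - ψ 0) ⊆ Ici 0))
    have hψu := isCompact_Icc.uniformContinuousOn_of_continuous hψc
    obtain ⟨η, hη, hfη⟩ := Metric.uniformContinuousOn_iff.1 hfu ε hε
    obtain ⟨δ, hδ, hψδ⟩ := Metric.uniformContinuousOn_iff.1 hψu η hη
    refine ⟨δ, hδ, fun s t₁ t₂ hs hs1 h12 h2 hd => ?_⟩
    have hsm : s ∈ Icc 0 T := ⟨hs, by linarith⟩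
    have h1m : t₁ ∈ Icc 0 T := ⟨by linarith, by linarith⟩
    have h2m : t₂ ∈ Icc 0 T := ⟨by linarith, h2⟩
    have hmem : ∀ t ∈ Icc 0 T, s ≤ t → ψ t - ψ s ∈ Icc 0 (ψ T - ψ 0) := fun t ht hst =>
      ⟨sub_nonneg.2 (hmono hsm ht hst),
        sub_le_sub (hmono ht ⟨hT.le, le_rfl⟩ ht.2) (hmono ⟨le_rfl, hT.le⟩ hsm hs)⟩
    rw [← dist_eq_norm]
    refine hfη _ (hmem _ h2m (hs1.trans h12)) _ (hmem _ h1m hs1) ?_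
    rw [dist_sub_right]
    exact hψδ _ h2m _ h1m (by rwa [Real.dist_eq, abs_of_nonneg (by linarith)])
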